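/- For complex $x,q$ with $|q|<1$ let $(x;q)_n=\prod_{j=0}^{n-1}(1-xq^j)$, $(x;q)_\infty=\prod_{j=0}^{\infty}(1-xq^j)$, and $(x_1,\dots,x_m;q)_n=\prod_{i=1}^m (x_i;q)_n$ for $n\in\{0,1,2,\dots\}\cup\{\infty\}$. Define $$f(a,k,z,q)=\sum_{n=1}^{\infty}\frac{(q\sqrt{k},-q\sqrt{k},k,z,k/a;q)_n}{(\sqrt{k},-\sqrt{k},qk,qk/z,qa;q)_n\,(1-q^n)}\left(\frac{qa}{z}\right)^n$$ (the choice of the square root is immaterial). Let $a,k,z,q\in\mathbb{C}$ with $0<|q|<1$, $k\neq 0$ and $|qa|<|z|<|a/q|$ (so that $a,z\ne0$), and suppose that none of the denominators below vanish, that is, none of $a,\ k,\ z/k,\ z/a$ is an integer power of $q$. Then the series defining $f(a,k,z,q)$ and $f(1/a,1/k,1/z,q)$ converge absolutely, and $$f(a,k,z,q)-f\left(\frac1a,\frac1k,\frac1z,q\right)=\frac{(a-k)(1-1/z)(1-ak/z)}{(1-a)(1-k)(1-a/z)(1-k/z)}+\frac{z}{k}\,\frac{(z,\,q/z,\,k/a,\,qa/k,\,ak/z,\,qz/(ak),\,q,\,q;q)_\infty}{(z/k,\,qk/z,\,z/a,\,qa/z,\,a,\,q/a,\,k,\,q/k;q)_\infty}.$$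 -/

import Mathlib

/-- The finite `q`-shifted factorial `(a; q)_n = (1 - a) (1 - a q) ⋯ (1 - a q ^ (n - 1))`. -/
noncomputable def qPoch (a q : ℂ) (n : ℕ) : ℂ :=
  ∏ j ∈ Finset.range n, (1 - a * q ^ j)

/-- The infinite `q`-shifted factorial `(a; q)_∞ = (1 - a) (1 - a q) (1 - a q ^ 2) ⋯`. -/
noncomputable def qPochInf (a q : ℂ) : ℂ :=
  ∏' j : ℕ, (1 - a * q ^ j)

/-- For `|q| < 1` the product defining `(a; q)_∞` converges. -/
theorem qPochInf_multipliable (a q : ℂ) (hq : ‖q‖ < 1) :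
    Multipliable (fun j : ℕ => 1 - a * q ^ j) := by
  have h : Summable fun j : ℕ => ‖-(a * q ^ j)‖ := by
    simpa [norm_mul, norm_pow] using
      (summable_geometric_of_lt_one (norm_nonneg q) hq).mul_left ‖a‖
  simpa [sub_eq_add_neg] using multipliable_one_add_of_summable h

/-- `(a₁, a₂, …, aⱼ; q)_n = (a₁; q)_n (a₂; q)_n ⋯ (aⱼ; q)_n`. -/
noncomputable def qPochs (l : List ℂ) (q : ℂ) (n : ℕ) : ℂ :=
  (l.map fun a => qPoch a q n).prod

/-- `(a₁, a₂, …, aⱼ; q)_∞ = (a₁; q)_∞ (a₂; q)_∞ ⋯ (aⱼ; q)_∞`. -/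
noncomputable def qPochsInf (l : List ℂ) (q : ℂ) : ℂ :=
  (l.map fun a => qPochInf a q).prod

/-- The `n`-th term (`n ≥ 1`) of the very-well-poised series `f(a, k, z, q)`. Both square roots of
`k` enter symmetrically, so the choice of branch does not matter. -/
noncomputable def fTerm (a k z q : ℂ) (n : ℕ) : ℂ :=
  qPochs [q * Complex.sqrt k, -(q * Complex.sqrt k), k, z, k / a] q n /
    (qPochs [Complex.sqrt k, -Complex.sqrt k, q * k, q * k / z, q * a] q n * (1 - q ^ n)) *
    (q * a / z) ^ n

/-- The series `f(a, k, z, q)`, summed over `n = 1, 2, 3, …`. -/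
noncomputable def fSeries (a k z q : ℂ) : ℂ :=
  ∑' n : ℕ, fTerm a k z q (n + 1)

/-! Write `L(x) = ∑_{m≥1} x q^m / (1 - x q^m)`. Replacing `(a, k)` by `(aq, kq)` fixes `z` and
`k/a`, and the termwise difference of the two series has a closed-form antidifference
(`vwpTerm_sub_shift`). Its boundary value is the first term of `L(k) + L(a/z) - L(k/z) - L(a)`. The
`N`-fold shifted series is `O(|q|^N)`, so iterating gives `f(a,k,z,q) = L(k) + L(a/z) - L(k/z) -
L(a)` (`tsum_vwpTerm`).

Subtracting the formula at the inverted parameters pairs each `L(x)` with `L(1/x)`. Put `Λ(x) =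
x/(1-x) + L(x) - L(1/x)`, which equals `-x θ'(x)/θ(x)` for `θ(x) = (x, q/x; q)_∞`. The difference of
the two series is `Λ(k) + Λ(a/z) - Λ(k/z) - Λ(a)` minus the same combination of the terms `x/(1-x)`;
the latter gives the rational part.

The `Λ` combination is the infinite product: this is Weierstrass' three-term relation
(`qTheta_three_term`) differentiated where one of its products has a simple zero
(`thetaLambert_mul_qTheta`). Jacobi's triple product turns `θ(xy)θ(x/y)` into a 2×2 determinant in
theta series of `x` and `y`, and the three-term relation is then a Plücker identity. -/

open Filter Topology

/-! ### Finite and infinite `q`-shifted factorials -/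

theorem qPoch_succ (x q : ℂ) (n : ℕ) : qPoch x q (n + 1) = qPoch x q n * (1 - x * q ^ n) :=
  Finset.prod_range_succ _ _

theorem qPoch_zero (x q : ℂ) : qPoch x q 0 = 1 := Finset.prod_range_zero _

theorem qPoch_add (x q : ℂ) (m n : ℕ) :
    qPoch x q (m + n) = qPoch x q m * qPoch (x * q ^ m) q n := by
  simp only [qPoch, Finset.prod_range_add, pow_add, mul_assoc]

theorem qPoch_shift (x q : ℂ) (n : ℕ) :
    (1 - x) * qPoch (q * x) q n = qPoch x q n * (1 - x * q ^ n) := by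
  rw [← qPoch_succ, add_comm n 1, qPoch_add, qPoch_succ, qPoch_zero]
  simp [mul_comm]

theorem qPoch_ne_zero {x q : ℂ} (h : ∀ n : ℕ, x * q ^ n ≠ 1) (n : ℕ) : qPoch x q n ≠ 0 :=
  Finset.prod_ne_zero_iff.2 fun j _ => sub_ne_zero.2 (h j).symm

theorem summable_norm_mul_pow (x : ℂ) {q : ℂ} (hq : ‖q‖ < 1) :
    Summable fun j : ℕ => ‖x * q ^ j‖ := by
  simpa [norm_mul, norm_pow] using
    (summable_geometric_of_lt_one (norm_nonneg q) hq).mul_left ‖x‖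

theorem qPochInf_ne_zero {x q : ℂ} (hq : ‖q‖ < 1) (h : ∀ n : ℕ, x * q ^ n ≠ 1) :
    qPochInf x q ≠ 0 := by
  have := tprod_one_add_ne_zero_of_summable (f := fun j : ℕ => -(x * q ^ j))
    (fun j => by simpa [← sub_eq_add_neg] using sub_ne_zero.2 (h j).symm)
    (by simpa using summable_norm_mul_pow x hq)
  simpa [qPochInf, sub_eq_add_neg] using this

theorem tendsto_qPoch (x : ℂ) {q : ℂ} (hq : ‖q‖ < 1) :
    Tendsto (qPoch x q) atTop (𝓝 (qPochInf x q)) :=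
  (qPochInf_multipliable x q hq).tendsto_prod_tprod_nat

theorem exists_norm_le_of_tendsto {u : ℕ → ℂ} {l : ℂ} (h : Tendsto u atTop (𝓝 l)) :
    ∃ C, 0 ≤ C ∧ ∀ n, ‖u n‖ ≤ C := by
  obtain ⟨C, hC⟩ := (Metric.isBounded_range_of_tendsto u h).exists_norm_le
  exact ⟨C, (norm_nonneg _).trans (hC _ ⟨0, rfl⟩), fun n => hC _ ⟨n, rfl⟩⟩

theorem exists_norm_qPoch_le (x : ℂ) {q : ℂ} (hq : ‖q‖ < 1) :
    ∃ C, 0 ≤ C ∧ ∀ n, ‖qPoch x q n‖ ≤ C :=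
  exists_norm_le_of_tendsto (tendsto_qPoch x hq)

/-- The bound is uniform in the shift `N` because `(x q^N; q)_n` is the quotient of `(x; q)_{N+n}`
by `(x; q)_N`, both bounded and bounded away from zero. -/
theorem exists_norm_inv_qPoch_le {x q : ℂ} (hq : ‖q‖ < 1) (h : ∀ n : ℕ, x * q ^ n ≠ 1) :
    ∃ C, 0 ≤ C ∧ ∀ N n, ‖(qPoch (x * q ^ N) q n)⁻¹‖ ≤ C := by
  obtain ⟨C, hC0, hC⟩ := exists_norm_qPoch_le x hq
  obtain ⟨D, hD0, hD⟩ := exists_norm_le_of_tendsto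
    ((tendsto_qPoch x hq).inv₀ (qPochInf_ne_zero hq h))
  refine ⟨C * D, by positivity, fun N n => ?_⟩
  have e : (qPoch (x * q ^ N) q n)⁻¹ = qPoch x q N * (qPoch x q (N + n))⁻¹ := by
    have h1 := qPoch_ne_zero h N
    rw [qPoch_add, mul_inv, mul_inv_cancel_left₀ h1]
  rw [e, norm_mul]
  exact mul_le_mul (hC _) (hD _) (norm_nonneg _) hC0

/-- The factors tend to 1. No nonvanishing is needed: a zero factor has inverse 0 by convention. -/
theorem exists_norm_inv_one_sub_le (x : ℂ) {q : ℂ} (hq : ‖q‖ < 1) :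
    ∃ C, 0 ≤ C ∧ ∀ n : ℕ, ‖(1 - x * q ^ n)⁻¹‖ ≤ C := by
  have h1 : Tendsto (fun n : ℕ => 1 - x * q ^ n) atTop (𝓝 1) := by
    simpa using ((tendsto_pow_atTop_nhds_zero_of_norm_lt_one hq).const_mul x).const_sub 1
  exact exists_norm_le_of_tendsto (h1.inv₀ one_ne_zero)

theorem pow_succ_ne_one {q : ℂ} (hq : ‖q‖ < 1) (n : ℕ) : q ^ (n + 1) ≠ 1 := by
  intro h
  have := congrArg norm h
  rw [norm_pow, norm_one] at this
  exact absurd this (pow_lt_one₀ (norm_nonneg q) hq n.succ_ne_zero).ne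

/-! ### The very-well-poised series as a combination of Lambert series -/

/-- The hypergeometric part `(z, k/a; q)_n / (qk/z, qa; q)_n (qa/z)^n` of the summand. -/
noncomputable def vwpBase (a k z q : ℂ) (n : ℕ) : ℂ :=
  qPoch z q n * qPoch (k / a) q n * ((qPoch (q * k / z) q n)⁻¹ * (qPoch (q * a) q n)⁻¹) *
    (q * a / z) ^ n

/-- The summand of `f(a, k, z, q)` with the square roots cleared. -/
noncomputable def vwpTerm (a k z q : ℂ) (n : ℕ) : ℂ :=
  (1 - k * q ^ n * q ^ n) * ((1 - k * q ^ n)⁻¹ * (1 - q ^ n)⁻¹) * vwpBase a k z q n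

/-- An antidifference of `vwpTerm a k z q - vwpTerm (a * q) (k * q) z q`. -/
noncomputable def vwpGosper (a k z q : ℂ) (n : ℕ) : ℂ :=
  (1 - k * q ^ n * (q * a / z)) * ((1 - q * a / z)⁻¹ * (1 - k * q ^ n)⁻¹) * vwpBase a k z q n

theorem sqrt_mul_self (k : ℂ) : Complex.sqrt k * Complex.sqrt k = k := by
  rw [← pow_two]
  simp [Complex.sqrt]

theorem fTerm_eq_vwpTerm {a k z q : ℂ} (hk : ∀ n : ℕ, k * q ^ n ≠ 1) (n : ℕ) :
    fTerm a k z q n = vwpTerm a k z q n := by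
  have hs := sqrt_mul_self k
  set s := Complex.sqrt k
  have hs1 : ∀ n : ℕ, s * q ^ n ≠ 1 := fun n h => hk (n + n) <| by
    rw [← hs, pow_add]; linear_combination (s * q ^ n + 1) * h
  have hs2 : ∀ n : ℕ, -s * q ^ n ≠ 1 := fun n h => hk (n + n) <| by
    rw [← hs, pow_add]; linear_combination (-s * q ^ n + 1) * h
  have e1 := qPoch_shift s q n
  have e2 := qPoch_shift (-s) q n
  have e3 := qPoch_shift k q n
  have n1 := qPoch_ne_zero hs1 n
  have n2 := qPoch_ne_zero hs2 n
  have n3 := qPoch_ne_zero hk n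
  have m1 : 1 - s ≠ 0 := sub_ne_zero.2 (by simpa using (hs1 0).symm)
  have m2 : 1 - -s ≠ 0 := sub_ne_zero.2 (by simpa using (hs2 0).symm)
  have m3 : 1 - k ≠ 0 := sub_ne_zero.2 (by simpa using (hk 0).symm)
  have m4 : 1 - k * q ^ n ≠ 0 := sub_ne_zero.2 (hk n).symm
  have f1 : qPoch (q * s) q n = qPoch s q n * (1 - s * q ^ n) / (1 - s) := by
    rw [eq_div_iff m1, ← e1, mul_comm]
  have f2 : qPoch (-(q * s)) q n = qPoch (-s) q n * (1 - -s * q ^ n) / (1 - -s) := by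
    rw [eq_div_iff m2, ← e2, mul_comm, mul_neg]
  have f3 : qPoch (q * k) q n = qPoch k q n * (1 - k * q ^ n) / (1 - k) := by
    rw [eq_div_iff m3, ← e3, mul_comm]
  -- The factors at `s` and `-s` pair up through `s ^ 2 = k`, which removes the square root.
  have r1 : qPoch (q * s) q n * qPoch (-(q * s)) q n * qPoch k q n /
      (qPoch s q n * qPoch (-s) q n * qPoch (q * k) q n) =
      (1 - k * q ^ n * q ^ n) * (1 - k * q ^ n)⁻¹ := by
    rw [f1, f2, f3, ← hs] at *
    generalize qPoch s q n = A at *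
    generalize qPoch (-s) q n = B at *
    generalize qPoch (s * s) q n = C at *
    generalize q ^ n = Q at *
    field_simp
    ring
  simp only [fTerm, qPochs, List.map_cons, List.map_nil, List.prod_cons, List.prod_nil, mul_one,
    vwpTerm, vwpBase]
  rw [mul_assoc (1 - k * q ^ n * q ^ n) (1 - k * q ^ n)⁻¹ _ |>.symm, ← r1]
  simp only [div_eq_mul_inv, mul_inv]
  ring

theorem vwpBase_succ (a k z q : ℂ) (n : ℕ) :
    vwpBase a k z q (n + 1) = vwpBase a k z q n * ((1 - z * q ^ n) * (1 - k / a * q ^ n) *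
      ((1 - q * k / z * q ^ n)⁻¹ * (1 - q * a * q ^ n)⁻¹) * (q * a / z)) := by
  simp only [vwpBase, qPoch_succ, pow_succ, mul_inv]
  ring

/-- Only the denominator factorials and the power change under the shift, so the quotient is
rational in `q ^ n`. -/
theorem vwpBase_shift {a k z q : ℂ} (ha : a ≠ 0) (hz : z ≠ 0) (hq : q ≠ 0)
    (hka : ∀ n : ℕ, k * q ^ (n + 1) ≠ z) (haq : ∀ n : ℕ, a * q ^ (n + 1) ≠ 1) (n : ℕ) :
    vwpBase (a * q) (k * q) z q n = vwpBase a k z q n * (q ^ n * (1 - q * k / z) * (1 - q * a) *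
      ((1 - q * k / z * q ^ n)⁻¹ * (1 - q * a * q ^ n)⁻¹)) := by
  have h1 : ∀ n : ℕ, q * k / z * q ^ n ≠ 1 := fun n h => hka n <| by
    field_simp at h; rw [← h]; ring
  have h2 : ∀ n : ℕ, q * a * q ^ n ≠ 1 := fun n h => haq n <| by rw [← h]; ring
  have e1 := qPoch_shift (q * k / z) q n
  have e2 := qPoch_shift (q * a) q n
  have m1 : 1 - q * k / z ≠ 0 := sub_ne_zero.2 (by simpa using (h1 0).symm)
  have m2 : 1 - q * a ≠ 0 := sub_ne_zero.2 (by simpa using (h2 0).symm)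
  have f1 : (qPoch (q * (k * q) / z) q n)⁻¹ =
      (qPoch (q * k / z) q n)⁻¹ * (1 - q * k / z * q ^ n)⁻¹ * (1 - q * k / z) := by
    rw [← mul_inv, ← e1, mul_inv, show q * (k * q) / z = q * (q * k / z) by ring,
      mul_right_comm, inv_mul_cancel₀ m1, one_mul]
  have f2 : (qPoch (q * (a * q)) q n)⁻¹ =
      (qPoch (q * a) q n)⁻¹ * (1 - q * a * q ^ n)⁻¹ * (1 - q * a) := by
    rw [← mul_inv, ← e2, mul_inv, show q * (a * q) = q * (q * a) by ring,
      mul_right_comm, inv_mul_cancel₀ m2, one_mul]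
  have f3 : k * q / (a * q) = k / a := by field_simp
  have f4 : q * (a * q) / z = q * a / z * q := by ring
  simp only [vwpBase, f1, f2, f3, f4, mul_pow]
  ring

/-- Dividing by the common `vwpBase` leaves an identity of rational functions in `Q = q ^ (n + 1)`.
The pole at `Q = 1` cancels in the difference, which is why the antidifference has no factor `1 - Q`
below. -/
theorem vwpTerm_sub_shift {a k z q : ℂ} (ha : a ≠ 0) (hz : z ≠ 0) (hq : q ≠ 0) (hq1 : ‖q‖ < 1)
    (hk : ∀ n : ℕ, k * q ^ (n + 1) ≠ 1) (hkz : ∀ n : ℕ, k * q ^ (n + 1) ≠ z)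
    (haq : ∀ n : ℕ, a * q ^ (n + 1) ≠ 1) (haz : q * a ≠ z) (n : ℕ) :
    vwpTerm a k z q (n + 1) - vwpTerm (a * q) (k * q) z q (n + 1) =
      vwpGosper a k z q (n + 1) - vwpGosper a k z q (n + 2) := by
  have hQ : 1 - q ^ (n + 1) ≠ 0 := sub_ne_zero.2 (pow_succ_ne_one hq1 n).symm
  have h1 : 1 - k * q ^ (n + 1) ≠ 0 := sub_ne_zero.2 (hk n).symm
  have h2 : 1 - k * (q ^ (n + 1) * q) ≠ 0 :=
    sub_ne_zero.2 (by simpa [pow_succ] using (hk (n + 1)).symm)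
  have h3 : z - q * k * q ^ (n + 1) ≠ 0 :=
    sub_ne_zero.2 fun h => hkz (n + 1) (by rw [h]; ring)
  have h4 : 1 - q * a * q ^ (n + 1) ≠ 0 :=
    sub_ne_zero.2 fun h => haq (n + 1) (by rw [h]; ring)
  have h5 : z - q * a ≠ 0 := sub_ne_zero.2 haz.symm
  simp only [vwpTerm, vwpGosper]
  rw [vwpBase_shift ha hz hq hkz haq, show n + 2 = (n + 1) + 1 from rfl,
    vwpBase_succ a k z q (n + 1), pow_succ q (n + 1)]
  generalize vwpBase a k z q (n + 1) = B
  generalize q ^ (n + 1) = Q at *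
  have e3 : 1 - q * k / z * Q = (z - q * k * Q) / z := by field_simp
  have e5 : 1 - q * a / z = (z - q * a) / z := by field_simp
  have g2 : 1 - k * Q * q ≠ 0 := by convert h2 using 1; ring
  have g3 : z - k * Q * q ≠ 0 := by convert h3 using 1; ring
  have g4 : 1 - Q * q * a ≠ 0 := by convert h4 using 1; ring
  rw [e3, e5]
  field_simp
  ring

/-- Isolates `q ^ (N * n)`, the source of the decay in `N`; the other factors are in the shape of
the uniform bounds, hence `1 * q ^ n`. -/
theorem vwpTerm_shift_eq (a k z : ℂ) {q : ℂ} (hq : q ≠ 0) (N n : ℕ) :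
    vwpTerm (a * q ^ N) (k * q ^ N) z q n =
      (1 - k * q ^ (N + n + n)) * ((1 - k * q ^ (N + n))⁻¹ * (1 - 1 * q ^ n)⁻¹) *
      (qPoch z q n * qPoch (k / a) q n * ((qPoch (q * k / z * q ^ N) q n)⁻¹ *
        (qPoch (q * a * q ^ N) q n)⁻¹) * ((q * a / z) ^ n * q ^ (N * n))) := by
  have e1 : k * q ^ N / (a * q ^ N) = k / a := mul_div_mul_right _ _ (pow_ne_zero _ hq)
  have e2 : q * (k * q ^ N) / z = q * k / z * q ^ N := by ring
  have e3 : q * (a * q ^ N) = q * a * q ^ N := by ring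
  have e4 : q * a * q ^ N / z = q * a / z * q ^ N := by ring
  rw [vwpTerm, vwpBase, e1, e2, e3, e4, mul_pow, ← pow_mul]
  simp only [pow_add, mul_assoc, one_mul]

theorem exists_norm_vwpTerm_shift_le {a k z q : ℂ} (hz : z ≠ 0) (hq : q ≠ 0) (hq1 : ‖q‖ < 1)
    (hkz : ∀ n : ℕ, k * q ^ (n + 1) ≠ z) (haq : ∀ n : ℕ, a * q ^ (n + 1) ≠ 1) :
    ∃ C, 0 ≤ C ∧ ∀ N n : ℕ, ‖vwpTerm (a * q ^ N) (k * q ^ N) z q (n + 1)‖ ≤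
      C * ‖q‖ ^ N * ‖q * a / z‖ ^ (n + 1) := by
  have h1 : ∀ n : ℕ, q * k / z * q ^ n ≠ 1 := fun n h => hkz n <| by
    field_simp at h; rw [← h]; ring
  have h2 : ∀ n : ℕ, q * a * q ^ n ≠ 1 := fun n h => haq n <| by rw [← h]; ring
  obtain ⟨C1, p1, b1⟩ := exists_norm_inv_one_sub_le k hq1
  obtain ⟨C2, p2, b2⟩ := exists_norm_inv_one_sub_le 1 hq1
  obtain ⟨C3, p3, b3⟩ := exists_norm_qPoch_le z hq1
  obtain ⟨C4, p4, b4⟩ := exists_norm_qPoch_le (k / a) hq1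
  obtain ⟨C5, p5, b5⟩ := exists_norm_inv_qPoch_le hq1 h1
  obtain ⟨C6, p6, b6⟩ := exists_norm_inv_qPoch_le hq1 h2
  refine ⟨(1 + ‖k‖) * (C1 * C2) * (C3 * C4 * (C5 * C6)), by positivity, fun N n => ?_⟩
  have b0 : ‖1 - k * q ^ (N + (n + 1) + (n + 1))‖ ≤ 1 + ‖k‖ := by
    refine (norm_sub_le _ _).trans ?_
    rw [norm_one, norm_mul, norm_pow]
    gcongr
    exact mul_le_of_le_one_right (norm_nonneg _) (pow_le_one₀ (norm_nonneg _) hq1.le)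
  have b7 : ‖q ^ (N * (n + 1))‖ ≤ ‖q‖ ^ N := by
    rw [norm_pow]
    exact pow_le_pow_of_le_one (norm_nonneg _) hq1.le (Nat.le_mul_of_pos_right _ n.succ_pos)
  rw [vwpTerm_shift_eq a k z hq]
  simp only [norm_mul, norm_pow (q * a / z)]
  calc _ ≤ (1 + ‖k‖) * (C1 * C2) * (C3 * C4 * (C5 * C6) *
        (‖q * a / z‖ ^ (n + 1) * ‖q‖ ^ N)) := by
        gcongr
        exacts [b1 _, b2 _, b3 _, b4 _, b5 _ _, b6 _ _]
    _ = _ := by ring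

theorem tendsto_vwpBase {a k z q : ℂ} (hz : z ≠ 0) (hq1 : ‖q‖ < 1)
    (hkz : ∀ n : ℕ, k * q ^ (n + 1) ≠ z) (haq : ∀ n : ℕ, a * q ^ (n + 1) ≠ 1)
    (haz : ‖q * a / z‖ < 1) : Tendsto (vwpBase a k z q) atTop (𝓝 0) := by
  have h1 : ∀ n : ℕ, q * k / z * q ^ n ≠ 1 := fun n h => hkz n <| by
    field_simp at h; rw [← h]; ring
  have h2 : ∀ n : ℕ, q * a * q ^ n ≠ 1 := fun n h => haq n <| by rw [← h]; ring
  unfold vwpBase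
  simpa using (((tendsto_qPoch z hq1).mul (tendsto_qPoch (k / a) hq1)).mul
    (((tendsto_qPoch _ hq1).inv₀ (qPochInf_ne_zero hq1 h1)).mul
      ((tendsto_qPoch _ hq1).inv₀ (qPochInf_ne_zero hq1 h2)))).mul
    (tendsto_pow_atTop_nhds_zero_of_norm_lt_one haz)

theorem tendsto_vwpGosper {a k z q : ℂ} (hz : z ≠ 0) (hq1 : ‖q‖ < 1)
    (hkz : ∀ n : ℕ, k * q ^ (n + 1) ≠ z) (haq : ∀ n : ℕ, a * q ^ (n + 1) ≠ 1)
    (haz : ‖q * a / z‖ < 1) : Tendsto (vwpGosper a k z q) atTop (𝓝 0) := by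
  have h0 := (tendsto_pow_atTop_nhds_zero_of_norm_lt_one hq1).const_mul k
  have h1 : Tendsto (fun n : ℕ => 1 - k * q ^ n) atTop (𝓝 1) := by simpa using h0.const_sub 1
  unfold vwpGosper
  simpa using (((h0.mul_const (q * a / z)).const_sub 1).mul
    ((h1.inv₀ one_ne_zero).const_mul (1 - q * a / z)⁻¹)).mul
      (tendsto_vwpBase hz hq1 hkz haq haz)

/-- The summand `x q ^ (n + 1) / (1 - x q ^ (n + 1))` of a Lambert series. -/
noncomputable def lambertTerm (x q : ℂ) (n : ℕ) : ℂ :=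
  x * q ^ (n + 1) / (1 - x * q ^ (n + 1))

theorem summable_lambertTerm (x : ℂ) {q : ℂ} (hq : ‖q‖ < 1) :
    Summable (lambertTerm x q) := by
  obtain ⟨C, p, b⟩ := exists_norm_inv_one_sub_le x hq
  refine Summable.of_norm_bounded
    (((summable_norm_mul_pow x hq).comp_injective (add_left_injective 1)).mul_right C) fun n => ?_
  rw [lambertTerm, div_eq_mul_inv, norm_mul]
  exact mul_le_mul_of_nonneg_left (b _) (norm_nonneg _)

/-- A partial fraction decomposition over the four denominator factors. -/
theorem vwpGosper_one {a k z q : ℂ} (ha : a ≠ 0) (hz : z ≠ 0)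
    (hk : k * q ≠ 1) (hkz : k * q ≠ z) (haq : a * q ≠ 1) (haz : q * a ≠ z) :
    vwpGosper a k z q 1 = lambertTerm k q 0 + lambertTerm (a / z) q 0 - lambertTerm (k / z) q 0 -
      lambertTerm a q 0 := by
  have h1 : 1 - k * q ≠ 0 := sub_ne_zero.2 hk.symm
  have h2 : z - k * q ≠ 0 := sub_ne_zero.2 hkz.symm
  have h3 : 1 - a * q ≠ 0 := sub_ne_zero.2 haq.symm
  have h4 : z - q * a ≠ 0 := sub_ne_zero.2 haz.symm
  have g2 : z - q * k ≠ 0 := by rwa [mul_comm]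
  have g4 : z - a * q ≠ 0 := by rwa [mul_comm]
  have g3 : 1 - q * a ≠ 0 := by rwa [mul_comm]
  have g1 : 1 - q * k ≠ 0 := by rwa [mul_comm]
  simp only [vwpGosper, vwpBase, lambertTerm, qPoch_succ, qPoch_zero, pow_one, pow_zero, one_mul,
    zero_add, mul_one]
  have e1 : 1 - q * a / z = (z - q * a) / z := by field_simp
  have e2 : 1 - q * k / z = (z - q * k) / z := by field_simp
  have e3 : 1 - a / z * q = (z - a * q) / z := by field_simp
  have e4 : 1 - k / z * q = (z - k * q) / z := by field_simp
  rw [e1, e2, e3, e4]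
  field_simp
  ring

theorem lambertTerm_shift (x q : ℂ) (N n : ℕ) :
    lambertTerm (x * q ^ N) q n = lambertTerm x q (N + n) := by
  simp only [lambertTerm, mul_assoc, ← pow_add, add_assoc]

theorem summable_vwpTerm_shift {a k z q : ℂ} (hz : z ≠ 0) (hq : q ≠ 0) (hq1 : ‖q‖ < 1)
    (hkz : ∀ n : ℕ, k * q ^ (n + 1) ≠ z) (haq : ∀ n : ℕ, a * q ^ (n + 1) ≠ 1)
    (haz : ‖q * a / z‖ < 1) (N : ℕ) :
    Summable fun n => vwpTerm (a * q ^ N) (k * q ^ N) z q (n + 1) := by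
  obtain ⟨C, -, hC⟩ := exists_norm_vwpTerm_shift_le hz hq hq1 hkz haq
  exact Summable.of_norm_bounded (((summable_geometric_of_lt_one (norm_nonneg _) haz).comp_injective
    (add_left_injective 1)).mul_left _) (hC N)

theorem tendsto_tsum_vwpTerm_shift {a k z q : ℂ} (hz : z ≠ 0) (hq : q ≠ 0) (hq1 : ‖q‖ < 1)
    (hkz : ∀ n : ℕ, k * q ^ (n + 1) ≠ z) (haq : ∀ n : ℕ, a * q ^ (n + 1) ≠ 1)
    (haz : ‖q * a / z‖ < 1) :
    Tendsto (fun N => ∑' n, vwpTerm (a * q ^ N) (k * q ^ N) z q (n + 1)) atTop (𝓝 0) := by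
  obtain ⟨C, -, hC⟩ := exists_norm_vwpTerm_shift_le hz hq hq1 hkz haq
  have hs := (summable_geometric_of_lt_one (norm_nonneg _) haz).comp_injective
    (add_left_injective 1)
  have hb : ∀ N, ‖∑' n, vwpTerm (a * q ^ N) (k * q ^ N) z q (n + 1)‖ ≤
      C * ‖q‖ ^ N * ∑' n, ‖q * a / z‖ ^ (n + 1) := fun N => by
    rw [← tsum_mul_left]
    exact tsum_of_norm_bounded (hs.mul_left _).hasSum (hC N)
  refine squeeze_zero_norm hb ?_
  simpa using ((tendsto_pow_atTop_nhds_zero_of_lt_one (norm_nonneg q) hq1).const_mul C).mul_const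
    (∑' n, ‖q * a / z‖ ^ (n + 1))

theorem tsum_vwpTerm_sub_shift {a k z q : ℂ} (ha : a ≠ 0) (hz : z ≠ 0) (hq : q ≠ 0)
    (hq1 : ‖q‖ < 1) (hk : ∀ n : ℕ, k * q ^ (n + 1) ≠ 1) (hkz : ∀ n : ℕ, k * q ^ (n + 1) ≠ z)
    (haq : ∀ n : ℕ, a * q ^ (n + 1) ≠ 1) (haz : ‖q * a / z‖ < 1) :
    (∑' n, vwpTerm a k z q (n + 1)) - ∑' n, vwpTerm (a * q) (k * q) z q (n + 1) =
      lambertTerm k q 0 + lambertTerm (a / z) q 0 - lambertTerm (k / z) q 0 -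
      lambertTerm a q 0 := by
  have hne : q * a ≠ z := by
    rintro rfl
    rw [div_self hz, norm_one] at haz
    exact lt_irrefl _ haz
  have s0 : Summable fun n => vwpTerm a k z q (n + 1) := by
    simpa using summable_vwpTerm_shift hz hq hq1 hkz haq haz 0
  have s1 : Summable fun n => vwpTerm (a * q) (k * q) z q (n + 1) := by
    simpa using summable_vwpTerm_shift hz hq hq1 hkz haq haz 1
  rw [← s0.tsum_sub s1, ← vwpGosper_one ha hz (by simpa using hk 0) (by simpa using hkz 0)
    (by simpa using haq 0) hne]
  refine tendsto_nhds_unique (s0.sub s1).hasSum.tendsto_sum_nat ?_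
  have hG := (tendsto_vwpGosper hz hq1 hkz haq haz).comp (tendsto_add_atTop_nat 1)
  have := hG.const_sub (vwpGosper a k z q 1)
  rw [sub_zero] at this
  refine this.congr fun m => ?_
  rw [Finset.sum_congr rfl fun n _ => vwpTerm_sub_shift ha hz hq hq1 hk hkz haq hne n]
  exact (Finset.sum_range_sub' (fun n => vwpGosper a k z q (n + 1)) m).symm

/-- The very-well-poised series as a combination of four Lambert series. -/
theorem tsum_vwpTerm {a k z q : ℂ} (ha : a ≠ 0) (hz : z ≠ 0) (hq : q ≠ 0) (hq1 : ‖q‖ < 1)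
    (hk : ∀ n : ℕ, k * q ^ (n + 1) ≠ 1) (hkz : ∀ n : ℕ, k * q ^ (n + 1) ≠ z)
    (haq : ∀ n : ℕ, a * q ^ (n + 1) ≠ 1) (haz : ‖q * a / z‖ < 1) :
    ∑' n, vwpTerm a k z q (n + 1) = (∑' n, lambertTerm k q n) + (∑' n, lambertTerm (a / z) q n) -
      (∑' n, lambertTerm (k / z) q n) - ∑' n, lambertTerm a q n := by
  set F : ℕ → ℂ := fun N => ∑' n, vwpTerm (a * q ^ N) (k * q ^ N) z q (n + 1) with hF
  -- The first Lambert term at `x q^N` is the `N`-th one at `x`, so the Lambert partial sums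
  -- telescope to `F 0 - F m`.
  have step : ∀ N, F N - F (N + 1) = lambertTerm k q N + lambertTerm (a / z) q N -
      lambertTerm (k / z) q N - lambertTerm a q N := fun N => by
    have hqN := pow_ne_zero N hq
    have := tsum_vwpTerm_sub_shift (a := a * q ^ N) (k := k * q ^ N) (mul_ne_zero ha hqN) hz hq hq1
      (fun n => by rw [mul_assoc, ← pow_add]; exact hk (N + n))
      (fun n => by rw [mul_assoc, ← pow_add]; exact hkz (N + n))
      (fun n => by rw [mul_assoc, ← pow_add]; exact haq (N + n))
      (by
        rw [show q * (a * q ^ N) / z = q * a / z * q ^ N by ring, norm_mul, norm_pow]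
        exact (mul_le_of_le_one_right (norm_nonneg _)
          (pow_le_one₀ (norm_nonneg _) hq1.le)).trans_lt haz)
    rw [mul_div_right_comm a, mul_div_right_comm k, lambertTerm_shift, lambertTerm_shift,
      lambertTerm_shift, lambertTerm_shift] at this
    simpa only [hF, pow_succ, mul_assoc, add_zero] using this
  have l1 := summable_lambertTerm k hq1
  have l2 := summable_lambertTerm (a / z) hq1
  have l3 := summable_lambertTerm (k / z) hq1
  have l4 := summable_lambertTerm a hq1
  rw [← l1.tsum_add l2, ← (l1.add l2).tsum_sub l3, ← ((l1.add l2).sub l3).tsum_sub l4]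
  refine Eq.symm (tendsto_nhds_unique (((l1.add l2).sub l3).sub l4).hasSum.tendsto_sum_nat ?_)
  have := (tendsto_tsum_vwpTerm_shift hz hq hq1 hkz haq haz).const_sub (F 0)
  have e0 : ∑' n, vwpTerm a k z q (n + 1) = F 0 := by simp [hF]
  rw [sub_zero] at this
  rw [e0]
  refine this.congr fun m => ?_
  rw [← Finset.sum_congr rfl fun n _ => step n, Finset.sum_range_sub']

/-! ### Jacobi's triple product -/

/-- The Gaussian binomial coefficient, zero outside the range `n ≤ M`. -/
noncomputable def gaussBinom (q : ℂ) (M n : ℕ) : ℂ :=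
  if n ≤ M then qPoch q q M * ((qPoch q q n)⁻¹ * (qPoch q q (M - n))⁻¹) else 0

theorem qPoch_self_ne_zero {q : ℂ} (hq : ‖q‖ < 1) (n : ℕ) : qPoch q q n ≠ 0 :=
  qPoch_ne_zero (fun n h => pow_succ_ne_one hq n (by rwa [pow_succ'])) n

theorem gaussBinom_zero_right {q : ℂ} (hq : ‖q‖ < 1) (M : ℕ) : gaussBinom q M 0 = 1 := by
  simp [gaussBinom, qPoch_zero, mul_inv_cancel₀ (qPoch_self_ne_zero hq M)]

theorem gaussBinom_self {q : ℂ} (hq : ‖q‖ < 1) (M : ℕ) : gaussBinom q M M = 1 := by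
  simp [gaussBinom, qPoch_zero, mul_inv_cancel₀ (qPoch_self_ne_zero hq M)]

theorem gaussBinom_succ_right (q : ℂ) (M : ℕ) : gaussBinom q M (M + 1) = 0 := by
  simp [gaussBinom]

/-- Pascal's rule multiplied by `q ^ n`, which avoids the exponent `M - n` and matches the growth of
`p ^ (n * (n - 1))` in the induction below. -/
theorem gaussBinom_pascal {q : ℂ} (hq : ‖q‖ < 1) {M n : ℕ} (h : n ≤ M) :
    q ^ n * gaussBinom q (M + 1) (n + 1) =
      q ^ n * gaussBinom q M (n + 1) + q ^ M * gaussBinom q M n := by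
  rcases h.eq_or_lt with rfl | h
  · rw [gaussBinom_self hq, gaussBinom_self hq, gaussBinom_succ_right]; ring
  obtain ⟨r, rfl⟩ := Nat.exists_eq_add_of_le (Nat.succ_le_of_lt h)
  have h1 : n + 1 ≤ n.succ + r + 1 := by omega
  have h2 : n + 1 ≤ n.succ + r := by omega
  have h3 : n ≤ n.succ + r := by omega
  have e1 : n.succ + r + 1 - (n + 1) = r + 1 := by omega
  have e2 : n.succ + r - (n + 1) = r := by omega
  have e3 : n.succ + r - n = r + 1 := by omega
  have n1 := qPoch_self_ne_zero hq n
  have n2 := qPoch_self_ne_zero hq r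
  have n3 : 1 - q * q ^ n ≠ 0 := by
    rw [← pow_succ']; exact sub_ne_zero.2 (pow_succ_ne_one hq n).symm
  have n4 : 1 - q * q ^ r ≠ 0 := by
    rw [← pow_succ']; exact sub_ne_zero.2 (pow_succ_ne_one hq r).symm
  simp only [gaussBinom, if_pos h1, if_pos h2, if_pos h3, e1, e2, e3]
  rw [qPoch_succ q q (n.succ + r), qPoch_succ q q n, qPoch_succ q q r]
  rw [show n.succ + r = n + r + 1 by omega]
  generalize qPoch q q (n + r + 1) = A
  generalize qPoch q q n = B at *
  generalize qPoch q q r = C at *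
  rw [pow_succ, pow_add]
  generalize q ^ n = D at *
  generalize q ^ r = E at *
  have n5 : 1 - D * q ≠ 0 := by rwa [mul_comm]
  have n6 : 1 - E * q ≠ 0 := by rwa [mul_comm]
  field_simp
  ring

/-- The `q`-binomial theorem, in base `q = p ^ 2`. -/
theorem qPoch_eq_sum {p : ℂ} (hp : ‖p ^ 2‖ < 1) (x : ℂ) (M : ℕ) :
    qPoch x (p ^ 2) M = ∑ n ∈ Finset.range (M + 1),
      (-1) ^ n * p ^ (n * (n - 1)) * gaussBinom (p ^ 2) M n * x ^ n := by
  induction M with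
  | zero => simp [qPoch_zero, gaussBinom_zero_right hp]
  | succ M ih =>
    have key : ∀ n ∈ Finset.range (M + 1),
        (-1) ^ (n + 1) * p ^ ((n + 1) * (n + 1 - 1)) * gaussBinom (p ^ 2) (M + 1) (n + 1) *
          x ^ (n + 1) =
        (-1) ^ (n + 1) * p ^ ((n + 1) * (n + 1 - 1)) * gaussBinom (p ^ 2) M (n + 1) * x ^ (n + 1) -
        (-1) ^ n * p ^ (n * (n - 1)) * gaussBinom (p ^ 2) M n * x ^ n * (x * (p ^ 2) ^ M) := by
      intro n hn
      have e : p ^ ((n + 1) * (n + 1 - 1)) = p ^ (n * (n - 1)) * (p ^ 2) ^ n := by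
        rw [← pow_mul, ← pow_add]
        congr 1
        cases n with
        | zero => rfl
        | succ n => simp only [Nat.add_sub_cancel]; ring
      have := gaussBinom_pascal hp (Nat.lt_succ_iff.1 (Finset.mem_range.1 hn))
      rw [e]
      linear_combination (-1) ^ (n + 1) * p ^ (n * (n - 1)) * x ^ (n + 1) * this
    rw [qPoch_succ, mul_sub, mul_one, Finset.sum_range_succ', Finset.sum_congr rfl key,
      Finset.sum_sub_distrib, ← Finset.sum_mul, ← ih, gaussBinom_zero_right hp]
    nth_rw 1 [ih]
    rw [Finset.sum_range_succ', gaussBinom_zero_right hp, Finset.sum_range_succ _ M,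
      gaussBinom_succ_right]
    ring

/-- With `q = p ^ 2`, pull `-x q^{-j}` out of each factor `1 - x q^{-j}`, `1 ≤ j ≤ N`. -/
theorem qPoch_mul_inv_pow {p x : ℂ} (hp : p ≠ 0) (hx : x ≠ 0) (N : ℕ) :
    qPoch (x * ((p ^ 2) ^ N)⁻¹) (p ^ 2) N =
      (-x) ^ N * (p ^ (N * (N + 1)))⁻¹ * qPoch (p ^ 2 / x) (p ^ 2) N := by
  induction N with
  | zero => simp [qPoch_zero]
  | succ N ih =>
    have e : x * ((p ^ 2) ^ (N + 1))⁻¹ * (p ^ 2) ^ 1 = x * ((p ^ 2) ^ N)⁻¹ := by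
      rw [pow_succ, mul_inv, pow_one, mul_assoc, inv_mul_cancel_right₀ (pow_ne_zero 2 hp)]
    rw [add_comm N 1, qPoch_add, add_comm 1 N, e, ih, qPoch_succ, qPoch_succ, qPoch_zero]
    have e2 : p ^ ((N + 1) * (N + 1 + 1)) = p ^ (N * (N + 1)) * (p ^ N * p) ^ 2 := by
      rw [← pow_succ, ← pow_mul, ← pow_add]; congr 1; ring
    have e3 : (p ^ 2) ^ N = (p ^ N) ^ 2 := by rw [← pow_mul, ← pow_mul, mul_comm]
    rw [e2, pow_succ (p ^ 2) N, e3]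
    have h1 := pow_ne_zero N hp
    have h2 := pow_ne_zero (N * (N + 1)) hp
    generalize p ^ (N * (N + 1)) = A at *
    generalize p ^ N = B at *
    field_simp
    ring

/-- The general term `(-1) ^ m p ^ (m (m - 1)) x ^ m` of the theta series in base `q = p ^ 2`. -/
noncomputable def thetaTerm (p x : ℂ) (m : ℤ) : ℂ := (-1) ^ m * p ^ (m * (m - 1)) * x ^ m

/-- The finite form of Jacobi's triple product. -/
theorem qPoch_mul_qPoch_eq_sum {p x : ℂ} (hp0 : p ≠ 0) (hp : ‖p ^ 2‖ < 1) (hx : x ≠ 0) (N : ℕ) :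
    qPoch x (p ^ 2) N * qPoch (p ^ 2 / x) (p ^ 2) N =
      ∑ n ∈ Finset.range (2 * N + 1),
        gaussBinom (p ^ 2) (2 * N) n * thetaTerm p x ((n : ℤ) - N) := by
  -- Starting the product at `x q^{-N}` centres its `2N` factors: the first half becomes `(q/x;
  -- q)_N` up to a monomial, the second is `(x; q)_N`.
  have h1 := qPoch_eq_sum hp (x * ((p ^ 2) ^ N)⁻¹) (2 * N)
  have hN := pow_ne_zero N (pow_ne_zero 2 hp0)
  rw [show 2 * N = N + N from two_mul N, qPoch_add, qPoch_mul_inv_pow hp0 hx, mul_assoc x,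
    inv_mul_cancel₀ hN, mul_one] at h1
  have h2 : qPoch x (p ^ 2) N * qPoch (p ^ 2 / x) (p ^ 2) N = (-x)⁻¹ ^ N * p ^ (N * (N + 1)) *
      ((-x) ^ N * (p ^ (N * (N + 1)))⁻¹ * qPoch (p ^ 2 / x) (p ^ 2) N * qPoch x (p ^ 2) N) := by
    have := pow_ne_zero N (neg_ne_zero.2 hx)
    have := pow_ne_zero (N * (N + 1)) hp0
    rw [inv_pow]
    field_simp
  rw [h2, h1, Finset.mul_sum, ← two_mul]
  refine Finset.sum_congr rfl fun n _ => ?_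
  have e1 : p ^ (n * (n - 1)) = p ^ ((n : ℤ) * (n - 1)) := by
    rw [← zpow_natCast]
    congr 1
    cases n with
    | zero => simp
    | succ n => push_cast; simp
  have e2 : p ^ (N * (N + 1)) = p ^ ((N : ℤ) * (N + 1)) := by
    rw [← zpow_natCast]; push_cast; rfl
  have e3 : ((p ^ 2) ^ N)⁻¹ ^ n = p ^ (-2 * (N : ℤ) * n) := by
    rw [← pow_mul, ← inv_pow, ← pow_mul, ← zpow_natCast, inv_zpow']
    push_cast; congr 1; ring
  have e4 : p ^ (((n : ℤ) - N) * (n - N - 1)) =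
      p ^ ((N : ℤ) * (N + 1)) * p ^ ((n : ℤ) * (n - 1)) * p ^ (-2 * (N : ℤ) * n) := by
    rw [← zpow_add₀ hp0, ← zpow_add₀ hp0]; congr 1; ring
  have e5 : ((-1 : ℂ)) ^ ((n : ℤ) - N) = (-1) ^ n * (-1) ^ N := by
    rw [zpow_sub₀ (by norm_num), zpow_natCast, zpow_natCast, div_eq_mul_inv, ← inv_pow]
    norm_num
  have e6 : x ^ ((n : ℤ) - N) = x ^ n * x⁻¹ ^ N := by
    rw [zpow_sub₀ hx, zpow_natCast, zpow_natCast, div_eq_mul_inv, inv_pow]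
  rw [thetaTerm, e4, e5, e6, mul_pow, e1, e2, e3, inv_neg, neg_pow (x⁻¹) N]
  ring

theorem summable_norm_pow_sq_mul_pow {r y : ℂ} (hr : r ≠ 0) (hr1 : ‖r‖ < 1) (hy : y ≠ 0) :
    Summable fun n : ℕ => ‖r ^ (n * n) * y ^ n‖ := by
  refine summable_of_ratio_test_tendsto_lt_one (l := 0) one_pos
    (.of_forall fun n => norm_ne_zero_iff.2 (mul_ne_zero (pow_ne_zero _ hr) (pow_ne_zero _ hy))) ?_
  have h : ∀ n : ℕ, ‖r‖ * ‖y‖ * (‖r‖ ^ n * ‖r‖ ^ n) =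
      ‖‖r ^ ((n + 1) * (n + 1)) * y ^ (n + 1)‖‖ / ‖‖r ^ (n * n) * y ^ n‖‖ := fun n => by
    have h1 := norm_ne_zero_iff.2 hr
    have h2 := norm_ne_zero_iff.2 hy
    simp only [norm_norm, norm_mul, norm_pow]
    rw [eq_div_iff (by positivity)]
    ring
  have h0 := tendsto_pow_atTop_nhds_zero_of_lt_one (norm_nonneg r) hr1
  simpa using ((h0.mul h0).const_mul (‖r‖ * ‖y‖)).congr h

theorem summable_norm_zpow_sq_mul_zpow {r y : ℂ} (hr : r ≠ 0) (hr1 : ‖r‖ < 1) (hy : y ≠ 0) :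
    Summable fun m : ℤ => ‖r ^ (m * m) * y ^ m‖ := by
  refine Summable.of_nat_of_neg ?_ ?_
  · refine (summable_norm_pow_sq_mul_pow hr hr1 hy).congr fun n => ?_
    rw [← Nat.cast_mul, zpow_natCast, zpow_natCast]
  · refine (summable_norm_pow_sq_mul_pow hr hr1 (inv_ne_zero hy)).congr fun n => ?_
    rw [neg_mul_neg, ← Nat.cast_mul, zpow_natCast, zpow_neg, zpow_natCast, inv_pow]

theorem summable_norm_thetaTerm {p x : ℂ} (hp0 : p ≠ 0) (hp : ‖p‖ < 1) (hx : x ≠ 0) :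
    Summable fun m => ‖thetaTerm p x m‖ := by
  refine (summable_norm_zpow_sq_mul_zpow hp0 hp (div_ne_zero hx hp0)).congr fun m => ?_
  rw [thetaTerm, mul_sub, zpow_sub₀ hp0, mul_one, div_zpow]
  simp only [norm_mul, norm_div, norm_zpow, norm_neg, norm_one, one_zpow, one_mul]
  ring

theorem exists_norm_gaussBinom_le {q : ℂ} (hq : ‖q‖ < 1) :
    ∃ C, 0 ≤ C ∧ ∀ M n, ‖gaussBinom q M n‖ ≤ C := by
  obtain ⟨C, p, b⟩ := exists_norm_qPoch_le q hq
  obtain ⟨D, p', b'⟩ := exists_norm_inv_qPoch_le (x := q) hq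
    (fun n h => pow_succ_ne_one hq n (by rwa [pow_succ']))
  have b'' : ∀ n, ‖(qPoch q q n)⁻¹‖ ≤ D := fun n => by simpa using b' 0 n
  refine ⟨C * (D * D), by positivity, fun M n => ?_⟩
  unfold gaussBinom
  split_ifs
  · rw [norm_mul, norm_mul]
    gcongr
    exacts [b _, b'' _, b'' _]
  · simpa using by positivity

theorem tendsto_gaussBinom {q : ℂ} (hq : ‖q‖ < 1) (m : ℤ) :
    Tendsto (fun N : ℕ => gaussBinom q (2 * N) (m + N).toNat) atTop (𝓝 (qPochInf q q)⁻¹) := by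
  have hne : qPochInf q q ≠ 0 :=
    qPochInf_ne_zero hq fun n h => pow_succ_ne_one hq n (by rwa [pow_succ'])
  have t := tendsto_qPoch q hq
  have t1 : Tendsto (fun N : ℕ => 2 * N) atTop atTop :=
    tendsto_atTop_mono (fun N => Nat.le_mul_of_pos_left N two_pos) tendsto_id
  have t2 : Tendsto (fun N : ℕ => (m + N).toNat) atTop atTop :=
    tendsto_atTop.2 fun b => by
      filter_upwards [eventually_ge_atTop (b + m.natAbs)] with N hN
      omega
  have t3 : Tendsto (fun N : ℕ => 2 * N - (m + N).toNat) atTop atTop :=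
    tendsto_atTop.2 fun b => by
      filter_upwards [eventually_ge_atTop (b + m.natAbs)] with N hN
      omega
  have key := (t.comp t1).mul (((t.comp t2).inv₀ hne).mul ((t.comp t3).inv₀ hne))
  rw [mul_inv_cancel_left₀ hne] at key
  refine key.congr' ?_
  filter_upwards [eventually_ge_atTop m.natAbs] with N hN
  rw [gaussBinom, if_pos (by omega)]
  rfl

/-- The theta function `(x, q/x; q)_∞`. -/
noncomputable def qTheta (q x : ℂ) : ℂ := qPochInf x q * qPochInf (q / x) q

/-- Jacobi's triple product. -/
theorem tsum_thetaTerm {p x : ℂ} (hp0 : p ≠ 0) (hp : ‖p‖ < 1) (hx : x ≠ 0) :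
    ∑' m, thetaTerm p x m = qPochInf (p ^ 2) (p ^ 2) * qTheta (p ^ 2) x := by
  have hq : ‖p ^ 2‖ < 1 := by
    rw [norm_pow]; exact pow_lt_one₀ (norm_nonneg _) hp two_ne_zero
  have hne : qPochInf (p ^ 2) (p ^ 2) ≠ 0 :=
    qPochInf_ne_zero hq fun n h => pow_succ_ne_one hq n (by rwa [pow_succ'])
  obtain ⟨C, hC0, hC⟩ := exists_norm_gaussBinom_le hq
  -- The finite sum, recentred by `m = n - N` and extended by zero to all integers, so that
  -- dominated convergence applies.
  let g : ℕ → ℤ → ℂ := fun N m =>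
    if m.natAbs ≤ N then gaussBinom (p ^ 2) (2 * N) (m + N).toNat * thetaTerm p x m else 0
  have hg : ∀ N, ∑' m, g N m = qPoch x (p ^ 2) N * qPoch (p ^ 2 / x) (p ^ 2) N := fun N => by
    rw [qPoch_mul_qPoch_eq_sum hp0 hq hx,
      tsum_eq_sum (s := (Finset.range (2 * N + 1)).image fun n : ℕ => (n : ℤ) - N)]
    · rw [Finset.sum_image fun a _ b _ h => by simpa using h]
      refine Finset.sum_congr rfl fun n hn => ?_
      have := Finset.mem_range.1 hn
      simp only [g]
      rw [if_pos (by omega), show ((n : ℤ) - N + N).toNat = n by omega]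
    · intro m hm
      refine if_neg fun h => hm (Finset.mem_image.2 ⟨(m + N).toNat, ?_, ?_⟩)
      · rw [Finset.mem_range]; omega
      · omega
  have hlim : Tendsto (fun N => ∑' m, g N m) atTop
      (𝓝 (∑' m, (qPochInf (p ^ 2) (p ^ 2))⁻¹ * thetaTerm p x m)) := by
    refine tendsto_tsum_of_dominated_convergence
      ((summable_norm_thetaTerm hp0 hp hx).mul_left C) (fun m => ?_) (.of_forall fun N m => ?_)
    · refine ((tendsto_gaussBinom hq m).mul_const (thetaTerm p x m)).congr' ?_
      filter_upwards [eventually_ge_atTop m.natAbs] with N hN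
      exact (if_pos hN).symm
    · simp only [g]
      split_ifs
      · rw [norm_mul]
        exact mul_le_mul_of_nonneg_right (hC _ _) (norm_nonneg _)
      · rw [norm_zero]; positivity
  simp only [hg] at hlim
  have := tendsto_nhds_unique hlim ((tendsto_qPoch x hq).mul (tendsto_qPoch (p ^ 2 / x) hq))
  rw [tsum_mul_left, inv_mul_eq_iff_eq_mul₀ hne] at this
  exact this

/-! ### The three-term relation for theta functions -/

/-- The general term of the theta series `∑ q ^ (i ^ 2) x ^ (2 i)` in base `q = p ^ 2`. -/
noncomputable def evenThetaTerm (p x : ℂ) (i : ℤ) : ℂ := p ^ (2 * (i * i)) * x ^ (2 * i)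

/-- The general term of the theta series `∑ q ^ (i ^ 2 + i) x ^ (2 i + 1)` in base `q = p ^ 2`. -/
noncomputable def oddThetaTerm (p x : ℂ) (i : ℤ) : ℂ :=
  p ^ (2 * (i * i) + 2 * i) * x ^ (2 * i + 1)

theorem summable_norm_evenThetaTerm {p x : ℂ} (hp0 : p ≠ 0) (hp : ‖p‖ < 1) (hx : x ≠ 0) :
    Summable fun i => ‖evenThetaTerm p x i‖ := by
  have hp2 : ‖p ^ (2 : ℤ)‖ < 1 := by
    rw [norm_zpow]; exact_mod_cast pow_lt_one₀ (norm_nonneg _) hp two_ne_zero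
  refine (summable_norm_zpow_sq_mul_zpow (zpow_ne_zero 2 hp0) hp2 (zpow_ne_zero 2 hx)).congr
    fun i => ?_
  rw [evenThetaTerm, zpow_mul p, zpow_mul x]

theorem summable_norm_oddThetaTerm {p x : ℂ} (hp0 : p ≠ 0) (hp : ‖p‖ < 1) (hx : x ≠ 0) :
    Summable fun i => ‖oddThetaTerm p x i‖ := by
  refine ((summable_norm_evenThetaTerm hp0 hp (mul_ne_zero hp0 hx)).mul_right ‖x‖).congr
    fun i => ?_
  rw [evenThetaTerm, oddThetaTerm, zpow_add₀ hp0, zpow_add_one₀ hx, mul_zpow, ← norm_mul]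
  ring_nf

theorem thetaTerm_mul_thetaTerm {p x y : ℂ} (hp0 : p ≠ 0) (hx : x ≠ 0) (hy : y ≠ 0) (m n : ℤ) :
    thetaTerm p (x * y) m * thetaTerm p (x / y) n =
      (-1) ^ (m + n) * p ^ (m * (m - 1) + n * (n - 1)) * x ^ (m + n) * y ^ (m - n) := by
  rw [thetaTerm, thetaTerm, zpow_add₀ (by norm_num), zpow_add₀ hp0, zpow_add₀ hx, zpow_sub₀ hy,
    mul_zpow, div_zpow]
  ring

/-- Pairs of integers, split by the parity of their sum. -/
def parityMap : (ℤ × ℤ) ⊕ (ℤ × ℤ) → ℤ × ℤ :=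
  Sum.elim (fun w => (w.1 + 1 + w.2, w.1 + 1 - w.2)) fun w => (w.1 + w.2 + 1, w.1 - w.2)

theorem parityMap_bijective : Function.Bijective parityMap := by
  constructor
  · rintro (⟨i, j⟩ | ⟨i, j⟩) (⟨i', j'⟩ | ⟨i', j'⟩) h <;>
      simp only [parityMap, Sum.elim_inl, Sum.elim_inr, Prod.mk.injEq] at h <;>
      first
        | (exfalso; omega)
        | (congr 2 <;> omega)
  · rintro ⟨m, n⟩
    rcases Int.even_or_odd' (m + n) with ⟨c, h | h⟩
    · refine ⟨Sum.inl (c - 1, m - c), ?_⟩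
      simp only [parityMap, Sum.elim_inl, Prod.mk.injEq]; omega
    · refine ⟨Sum.inr (c, m - c - 1), ?_⟩
      simp only [parityMap, Sum.elim_inr, Prod.mk.injEq]; omega

/-- Split the double sum by the parity of `m + n`, which is the sign of the term. In the coordinates
`m + n`, `m - n` the exponent of `p` separates. The even class is indexed by `m + n = 2i + 2`, so
that it yields `x` times the odd series in `x`. -/
theorem tsum_thetaTerm_mul_tsum_thetaTerm {p x y : ℂ} (hp0 : p ≠ 0) (hp : ‖p‖ < 1) (hx : x ≠ 0)
    (hy : y ≠ 0) :
    (∑' m, thetaTerm p (x * y) m) * ∑' n, thetaTerm p (x / y) n =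
      x * ((∑' i, oddThetaTerm p x i) * (∑' j, evenThetaTerm p y j) -
        (∑' i, evenThetaTerm p x i) * ∑' j, oddThetaTerm p y j) := by
  have s1 := summable_norm_thetaTerm hp0 hp (mul_ne_zero hx hy)
  have s2 := summable_norm_thetaTerm hp0 hp (div_ne_zero hx hy)
  have ox := summable_norm_oddThetaTerm hp0 hp hx
  have oy := summable_norm_oddThetaTerm hp0 hp hy
  have ex := summable_norm_evenThetaTerm hp0 hp hx
  have ey := summable_norm_evenThetaTerm hp0 hp hy
  rw [tsum_mul_tsum_of_summable_norm s1 s2, tsum_mul_tsum_of_summable_norm ox ey,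
    tsum_mul_tsum_of_summable_norm ex oy, ← (Equiv.ofBijective _ parityMap_bijective).tsum_eq]
  refine HasSum.tsum_eq ?_
  rw [mul_sub, sub_eq_add_neg, ← mul_neg]
  refine HasSum.sum ?_ ?_
  · refine Eq.mpr (congrArg (fun f => HasSum f _) (funext fun w => ?_))
      ((summable_mul_of_summable_norm ox ey).hasSum.mul_left x)
    simp only [Function.comp_apply, Equiv.ofBijective_apply, parityMap, Sum.elim_inl]
    rw [thetaTerm_mul_thetaTerm hp0 hx hy, oddThetaTerm, evenThetaTerm,
      show w.1 + 1 + w.2 + (w.1 + 1 - w.2) = 2 * w.1 + 1 + 1 by ring,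
      show w.1 + 1 + w.2 - (w.1 + 1 - w.2) = 2 * w.2 by ring,
      show (w.1 + 1 + w.2) * (w.1 + 1 + w.2 - 1) + (w.1 + 1 - w.2) * (w.1 + 1 - w.2 - 1) =
        2 * (w.1 * w.1) + 2 * w.1 + 2 * (w.2 * w.2) by ring,
      zpow_add₀ hp0 (2 * (w.1 * w.1) + 2 * w.1), zpow_add_one₀ hx (2 * w.1 + 1),
      Even.neg_one_zpow ⟨w.1 + 1, by ring⟩]
    ring
  · refine Eq.mpr (congrArg (fun f => HasSum f _) (funext fun w => ?_))
      ((summable_mul_of_summable_norm ex oy).hasSum.neg.mul_left x)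
    simp only [Function.comp_apply, Equiv.ofBijective_apply, parityMap, Sum.elim_inr]
    rw [thetaTerm_mul_thetaTerm hp0 hx hy, oddThetaTerm, evenThetaTerm,
      show w.1 + w.2 + 1 + (w.1 - w.2) = 2 * w.1 + 1 by ring,
      show w.1 + w.2 + 1 - (w.1 - w.2) = 2 * w.2 + 1 by ring,
      show (w.1 + w.2 + 1) * (w.1 + w.2 + 1 - 1) + (w.1 - w.2) * (w.1 - w.2 - 1) =
        2 * (w.1 * w.1) + (2 * (w.2 * w.2) + 2 * w.2) by ring,
      zpow_add₀ hp0 (2 * (w.1 * w.1)), zpow_add_one₀ hx (2 * w.1),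
      Odd.neg_one_zpow ⟨w.1, rfl⟩]
    ring

/-- Weierstrass' three-term relation. -/
theorem qTheta_three_term {q x y u v : ℂ} (hq0 : q ≠ 0) (hq : ‖q‖ < 1) (hx : x ≠ 0) (hy : y ≠ 0)
    (hu : u ≠ 0) (hv : v ≠ 0) :
    y * (qTheta q (x * y) * qTheta q (x / y) * (qTheta q (u * v) * qTheta q (u / v))) -
      u * (qTheta q (x * u) * qTheta q (x / u) * (qTheta q (y * v) * qTheta q (y / v))) +
      u * (qTheta q (x * v) * qTheta q (x / v) * (qTheta q (y * u) * qTheta q (y / u))) = 0 := by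
  obtain ⟨p, rfl⟩ := IsAlgClosed.exists_pow_nat_eq q two_pos
  have hp0 : p ≠ 0 := by rintro rfl; simp at hq0
  have hp : ‖p‖ < 1 := by
    rw [norm_pow] at hq
    exact (pow_lt_one_iff_of_nonneg (norm_nonneg p) two_ne_zero).1 hq
  set E := qPochInf (p ^ 2) (p ^ 2) with hE
  have hne : E ≠ 0 :=
    qPochInf_ne_zero hq fun n h => pow_succ_ne_one hq n (by rwa [pow_succ'])
  -- Each pair is a 2×2 determinant of the vectors (odd, even) at `s` and `t`; what remains is the
  -- Plücker relation for four vectors in the plane.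
  have key : ∀ {s t : ℂ}, s ≠ 0 → t ≠ 0 → qTheta (p ^ 2) (s * t) * qTheta (p ^ 2) (s / t) =
      s * ((∑' i, oddThetaTerm p s i) * (∑' j, evenThetaTerm p t j) -
        (∑' i, evenThetaTerm p s i) * ∑' j, oddThetaTerm p t j) / E ^ 2 := fun {s t} hs ht => by
    rw [← tsum_thetaTerm_mul_tsum_thetaTerm hp0 hp hs ht, tsum_thetaTerm hp0 hp (mul_ne_zero hs ht),
      tsum_thetaTerm hp0 hp (div_ne_zero hs ht), eq_div_iff (pow_ne_zero 2 hne)]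
    ring
  rw [key hx hy, key hu hv, key hx hu, key hy hv, key hx hv, key hy hu]
  ring

/-! ### The logarithmic derivative of the theta function -/

theorem hasProdLocallyUniformlyOn_qPochInf {q : ℂ} (hq : ‖q‖ < 1) (r : ℝ) :
    HasProdLocallyUniformlyOn (fun (j : ℕ) (x : ℂ) => 1 + -(x * q ^ j))
      (fun x => ∏' j : ℕ, (1 + -(x * q ^ j))) (Metric.ball 0 r) := by
  refine Summable.hasProdLocallyUniformlyOn_nat_one_add Metric.isOpen_ball
    ((summable_geometric_of_lt_one (norm_nonneg q) hq).mul_left r) (.of_forall fun n x hx => ?_)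
    fun n => by fun_prop
  rw [norm_neg, norm_mul, norm_pow]
  exact mul_le_mul_of_nonneg_right (mem_ball_zero_iff.1 hx).le (by positivity)

theorem differentiable_qPochInf {q : ℂ} (hq : ‖q‖ < 1) :
    Differentiable ℂ fun x => qPochInf x q := fun x => by
  have h := hasProdLocallyUniformlyOn_qPochInf hq (‖x‖ + 1)
  have hd : DifferentiableOn ℂ (fun x => ∏' j : ℕ, (1 + -(x * q ^ j))) (Metric.ball 0 (‖x‖ + 1)) :=
    TendstoLocallyUniformlyOn.differentiableOn h
      (.of_forall fun s => by fun_prop) Metric.isOpen_ball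
  have := hd.differentiableAt (Metric.isOpen_ball.mem_nhds (x := x) (by simp))
  simpa only [qPochInf, sub_eq_add_neg] using this

theorem hasDerivAt_qPochInf {x q : ℂ} (hq : ‖q‖ < 1) (hx : ∀ n : ℕ, x * q ^ n ≠ 1) :
    HasDerivAt (fun x => qPochInf x q) (-(qPochInf x q * ∑' j : ℕ, q ^ j / (1 - x * q ^ j))) x := by
  have hne := qPochInf_ne_zero hq hx
  have hl : ∀ j : ℕ, logDeriv (fun y : ℂ => 1 + -(y * q ^ j)) x = -(q ^ j / (1 - x * q ^ j)) :=
    fun j => by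
      have hd : HasDerivAt (fun y : ℂ => 1 + -(y * q ^ j)) (-(1 * q ^ j)) x :=
        (((hasDerivAt_id x).mul_const _).neg).const_add 1
      rw [logDeriv_apply, hd.deriv]
      ring
  have hs : Summable fun j : ℕ => q ^ j / (1 - x * q ^ j) := by
    obtain ⟨C, p, b⟩ := exists_norm_inv_one_sub_le x hq
    refine Summable.of_norm_bounded
      ((summable_geometric_of_lt_one (norm_nonneg q) hq).mul_right C) fun n => ?_
    rw [div_eq_mul_inv, norm_mul, norm_pow]
    exact mul_le_mul_of_nonneg_left (b _) (by positivity)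
  have h := logDeriv_tprod_eq_tsum (f := fun (j : ℕ) (y : ℂ) => 1 + -(y * q ^ j))
    Metric.isOpen_ball (x := x) (s := Metric.ball 0 (‖x‖ + 1)) (by simp)
    (fun j => by simpa [← sub_eq_add_neg] using sub_ne_zero.2 (hx j).symm)
    (fun j => by fun_prop) (by simpa only [hl] using hs.neg)
    (hasProdLocallyUniformlyOn_qPochInf hq _).multipliableLocallyUniformlyOn
    (by simpa only [qPochInf, sub_eq_add_neg] using hne)
  simp only [hl, tsum_neg] at h
  have h' : logDeriv (fun y => qPochInf y q) x = -∑' j : ℕ, q ^ j / (1 - x * q ^ j) := by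
    simpa only [qPochInf, sub_eq_add_neg] using h
  rw [logDeriv_apply, div_eq_iff hne] at h'
  refine (differentiable_qPochInf hq x).hasDerivAt.congr_deriv ?_
  rw [h']
  ring

/-- The logarithmic derivative `-x θ'(x) / θ(x)` of `θ(x) = (x, q/x; q)_∞` as a bilateral Lambert
series. -/
noncomputable def thetaLambert (q x : ℂ) : ℂ :=
  x / (1 - x) + ∑' n, lambertTerm x q n - ∑' n, lambertTerm (1 / x) q n

/-- Differentiating in a multiplicative parameter at 1 gives `x θ'(x)`. The factor `(q/x; q)_∞` sees
`t⁻¹`, hence the opposite sign of its Lambert series. -/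
theorem hasDerivAt_qTheta {x q : ℂ} (hq0 : q ≠ 0) (hq : ‖q‖ < 1) (hx0 : x ≠ 0)
    (hx : ∀ n : ℤ, x * q ^ n ≠ 1) :
    HasDerivAt (fun t => qTheta q (x * t)) (-(qTheta q x * thetaLambert q x)) 1 := by
  have h1 : ∀ n : ℕ, x * q ^ n ≠ 1 := fun n => by exact_mod_cast hx n
  have h2 : ∀ n : ℕ, q / x * q ^ n ≠ 1 := fun n h => hx (-(n + 1 : ℕ)) <| by
    have hqn := pow_ne_zero n hq0
    rw [zpow_neg, zpow_natCast, pow_succ]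
    field_simp at h ⊢
    rw [← h]
  have d1 := HasDerivAt.comp_of_eq (1 : ℂ) (hasDerivAt_qPochInf hq h1)
    ((hasDerivAt_id (1 : ℂ)).const_mul x) (mul_one x).symm
  have d2 := HasDerivAt.comp_of_eq (1 : ℂ) (hasDerivAt_qPochInf hq h2)
    ((hasDerivAt_inv (one_ne_zero (α := ℂ))).const_mul (q / x)) (by simp)
  have e1 : x * ∑' j : ℕ, q ^ j / (1 - x * q ^ j) = x / (1 - x) + ∑' n, lambertTerm x q n := by
    have hs : Summable fun j : ℕ => x * q ^ j / (1 - x * q ^ j) :=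
      (summable_nat_add_iff 1).1 (summable_lambertTerm x hq)
    rw [← tsum_mul_left]
    simp only [← mul_div_assoc]
    rw [hs.tsum_eq_zero_add]
    simp [lambertTerm]
  have e2 : q / x * ∑' j : ℕ, q ^ j / (1 - q / x * q ^ j) = ∑' n, lambertTerm (1 / x) q n := by
    rw [← tsum_mul_left]
    refine tsum_congr fun n => ?_
    rw [lambertTerm, ← mul_div_assoc, show q / x * q ^ n = 1 / x * q ^ (n + 1) by ring]
  have d := d1.mul d2
  have hf : (fun t => qTheta q (x * t)) =
      (fun t => qPochInf (x * t) q) * fun t => qPochInf (q / x * t⁻¹) q := by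
    funext t
    simp only [qTheta, Pi.mul_apply, div_eq_mul_inv q, mul_inv, mul_assoc]
  rw [hf]
  refine d.congr_deriv ?_
  simp only [qTheta, thetaLambert, ← e1, ← e2]
  simp
  ring

theorem qPochInf_eq_one_sub_mul {q : ℂ} (hq : ‖q‖ < 1) (t : ℂ) :
    qPochInf t q = (1 - t) * qPochInf (q * t) q := by
  refine tendsto_nhds_unique ((tendsto_qPoch t hq).comp (tendsto_add_atTop_nat 1))
    (((tendsto_qPoch (q * t) hq).const_mul (1 - t)).congr fun n => ?_)
  rw [qPoch_shift, ← qPoch_succ]; rfl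

theorem qTheta_inv {q x : ℂ} (hq : ‖q‖ < 1) (hx : x ≠ 0) :
    qTheta q x⁻¹ = -x⁻¹ * qTheta q x := by
  rw [qTheta, qTheta, qPochInf_eq_one_sub_mul hq x⁻¹, qPochInf_eq_one_sub_mul hq x, div_inv_eq_mul,
    ← div_eq_mul_inv]
  field_simp
  ring

theorem qTheta_one {q : ℂ} (hq : ‖q‖ < 1) : qTheta q 1 = 0 := by
  rw [qTheta, qPochInf_eq_one_sub_mul hq]; simp

theorem differentiableAt_qTheta {q x : ℂ} (hq : ‖q‖ < 1) (hx : x ≠ 0) :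
    DifferentiableAt ℂ (qTheta q) x := by
  have hD := differentiable_qPochInf hq
  refine (hD x).mul ?_
  exact (hD _).comp x (f := fun t => q / t)
    ((differentiableAt_const q).div differentiableAt_id hx)

/-- The simple zero comes from the factor `1 - t`; the cofactor at 1 is `(q; q)_∞ ^ 2`. -/
theorem hasDerivAt_qTheta_one {q : ℂ} (hq : ‖q‖ < 1) :
    HasDerivAt (qTheta q) (-(qPochInf q q * qPochInf q q)) 1 := by
  have hD := differentiable_qPochInf hq
  have hf : qTheta q = fun t => (1 - t) * (qPochInf (q * t) q * qPochInf (q / t) q) := by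
    funext t
    rw [qTheta, qPochInf_eq_one_sub_mul hq t, mul_assoc]
  have hg : DifferentiableAt ℂ (fun t => qPochInf (q * t) q * qPochInf (q / t) q) 1 := by
    refine DifferentiableAt.mul ?_ ?_
    · exact (hD _).comp 1 (by fun_prop)
    · exact (hD _).comp (1 : ℂ) (f := fun t => q / t)
        ((differentiableAt_const q).div differentiableAt_id one_ne_zero)
  have := ((hasDerivAt_id (1 : ℂ)).const_sub 1).mul hg.hasDerivAt
  rw [hf]
  exact this.congr_deriv (by simp)

/-- The degenerate form of the three-term relation: a product of theta functions as a combination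
of bilateral Lambert series. -/
theorem thetaLambert_mul_qTheta {a k z q : ℂ} (hq0 : q ≠ 0) (hq : ‖q‖ < 1) (ha0 : a ≠ 0)
    (hk0 : k ≠ 0) (hz0 : z ≠ 0) (ha : ∀ n : ℤ, a * q ^ n ≠ 1) (hk : ∀ n : ℤ, k * q ^ n ≠ 1)
    (hkz : ∀ n : ℤ, k / z * q ^ n ≠ 1) (haz : ∀ n : ℤ, a / z * q ^ n ≠ 1) :
    (thetaLambert q k + thetaLambert q (a / z) - thetaLambert q (k / z) - thetaLambert q a) *
        (k / z) * (qTheta q (z / k) * qTheta q (z / a) * qTheta q a * qTheta q k) =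
      qTheta q z * qTheta q (k / a) * qTheta q (a * k / z) * (qPochInf q q * qPochInf q q) := by
  -- The three-term relation is used at `(ts, k/s, a/s, s)`; `s ^ 2 = ak/z` makes every argument
  -- free of `s`, and `x / v = t`.
  obtain ⟨s, hs⟩ := IsAlgClosed.exists_pow_nat_eq (a * k / z) two_pos
  have hs0 : s ≠ 0 := by
    rintro rfl
    exact div_ne_zero (mul_ne_zero ha0 hk0) hz0 (by rw [← hs]; simp)
  have hs' : s ^ 2 * z = a * k := by rw [hs]; field_simp
  have haz0 := div_ne_zero ha0 hz0
  have hkz0 := div_ne_zero hk0 hz0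
  have hakz0 : a * k / z ≠ 0 := div_ne_zero (mul_ne_zero ha0 hk0) hz0
  have rel : (fun t : ℂ =>
      k * (qTheta q (k * t) * qTheta q (a / z * t) * (qTheta q a * qTheta q (z / k))) -
      a * (qTheta q (a * t) * qTheta q (k / z * t) * (qTheta q k * qTheta q (z / a))) +
      a * (qTheta q (a * k / z * t) * qTheta q t * (qTheta q z * qTheta q (k / a))))
      =ᶠ[𝓝 1] fun _ => 0 := by
    filter_upwards [isOpen_ne.mem_nhds (one_ne_zero (α := ℂ))] with t ht
    have := qTheta_three_term hq0 hq (mul_ne_zero ht hs0) (div_ne_zero hk0 hs0)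
      (div_ne_zero ha0 hs0) hs0
    have e1 : t * s * (k / s) = k * t := by field_simp
    have e2 : t * s / (k / s) = a / z * t := by
      field_simp; linear_combination hs'
    have e3 : t * s * (a / s) = a * t := by field_simp
    have e4 : t * s / (a / s) = k / z * t := by
      field_simp; linear_combination hs'
    have e5 : t * s * s = a * k / z * t := by rw [← hs]; ring
    have e6 : t * s / s = t := by field_simp
    have e7 : a / s * s = a := by field_simp
    have e8 : a / s / s = z / k := by
      field_simp; linear_combination -hs'
    have e9 : k / s * s = k := by field_simp
    have e10 : k / s / s = z / a := by
      field_simp; linear_combination -hs'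
    have e11 : k / s * (a / s) = z := by
      field_simp; linear_combination -hs'
    have e12 : k / s / (a / s) = k / a := by field_simp
    rw [e1, e2, e3, e4, e5, e6, e7, e8, e9, e10, e11, e12] at this
    have clear_s : ∀ X Y W : ℂ, k / s * X - a / s * Y + a / s * W = 0 →
        k * X - a * Y + a * W = 0 := fun X Y W h => by
      field_simp at h; linear_combination h
    exact clear_s _ _ _ this
  have dk := hasDerivAt_qTheta hq0 hq hk0 hk
  have da := hasDerivAt_qTheta hq0 hq ha0 ha
  have dkz := hasDerivAt_qTheta hq0 hq hkz0 hkz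
  have daz := hasDerivAt_qTheta hq0 hq haz0 haz
  have d1 := hasDerivAt_qTheta_one hq
  -- The value of this derivative is irrelevant, since its partner `θ(t)` vanishes at 1.
  have dakz : DifferentiableAt ℂ (fun t => qTheta q (a * k / z * t)) 1 :=
    DifferentiableAt.comp (1 : ℂ) (g := qTheta q) (f := fun t => a * k / z * t)
      (differentiableAt_qTheta hq (by rwa [mul_one])) (by fun_prop)
  have dd := ((((dk.mul daz).mul_const (qTheta q a * qTheta q (z / k))).const_mul k).sub
    (((da.mul dkz).mul_const (qTheta q k * qTheta q (z / a))).const_mul a)).add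
    (((dakz.hasDerivAt.mul d1).mul_const (qTheta q z * qTheta q (k / a))).const_mul a)
  have h0 := (dd.congr_of_eventuallyEq rel.symm).unique (hasDerivAt_const (1 : ℂ) (0 : ℂ))
  -- Inversion gives the first two products the same theta factors and the common coefficient
  -- `ak/z`.
  have i1 : qTheta q (a / z) = -(a / z) * qTheta q (z / a) := by
    rw [← inv_div, qTheta_inv hq (div_ne_zero hz0 ha0)]
  have i2 : qTheta q (k / z) = -(k / z) * qTheta q (z / k) := by
    rw [← inv_div, qTheta_inv hq (div_ne_zero hz0 hk0)]
  simp only [mul_one, qTheta_one hq, mul_zero, zero_add, i1, i2] at h0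
  field_simp at h0 ⊢
  refine mul_left_cancel₀ ha0 ?_
  linear_combination h0

/-! ### Assembly of the identity -/

theorem inv_mul_zpow_ne_one {x q : ℂ} (h : ∀ n : ℤ, x * q ^ n ≠ 1) (n : ℤ) :
    x⁻¹ * q ^ n ≠ 1 := fun e => h (-n) <| by
  rw [zpow_neg, ← inv_inv x, ← mul_inv, e, inv_one]

theorem mainTheorem2 (a k z q : ℂ) (hq0 : q ≠ 0) (hq1 : ‖q‖ < 1) (hk0 : k ≠ 0)
    (hz₁ : ‖q * a‖ < ‖z‖) (hz₂ : ‖z‖ < ‖a / q‖)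
    (ha : ∀ n : ℤ, a * q ^ n ≠ 1) (hk : ∀ n : ℤ, k * q ^ n ≠ 1)
    (hzk : ∀ n : ℤ, z / k * q ^ n ≠ 1) (hza : ∀ n : ℤ, z / a * q ^ n ≠ 1) :
    Summable (fun n : ℕ => fTerm a k z q (n + 1)) ∧
    Summable (fun n : ℕ => fTerm (1 / a) (1 / k) (1 / z) q (n + 1)) ∧
    fSeries a k z q - fSeries (1 / a) (1 / k) (1 / z) q =
      (a - k) * (1 - 1 / z) * (1 - a * k / z) /
          ((1 - a) * (1 - k) * (1 - a / z) * (1 - k / z)) +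
        z / k *
          (qPochsInf [z, q / z, k / a, q * a / k, a * k / z, q * z / (a * k), q, q] q /
            qPochsInf [z / k, q * k / z, z / a, q * a / z, a, q / a, k, q / k] q) := by
  have hz0 : z ≠ 0 := norm_pos_iff.1 ((norm_nonneg _).trans_lt hz₁)
  have ha0 : a ≠ 0 := by
    rintro rfl
    exact absurd ((norm_nonneg z).trans_lt hz₂) (by simp)
  have hkz : ∀ n : ℤ, k / z * q ^ n ≠ 1 := by simpa using inv_mul_zpow_ne_one hzk
  have haz : ∀ n : ℤ, a / z * q ^ n ≠ 1 := by simpa using inv_mul_zpow_ne_one hza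
  have ha' : ∀ n : ℤ, 1 / a * q ^ n ≠ 1 := by simpa using inv_mul_zpow_ne_one ha
  have hk' : ∀ n : ℤ, 1 / k * q ^ n ≠ 1 := by simpa using inv_mul_zpow_ne_one hk
  have nat : ∀ {x : ℂ}, (∀ n : ℤ, x * q ^ n ≠ 1) → ∀ n : ℕ, x * q ^ n ≠ 1 := fun h n => by
    exact_mod_cast h n
  have ne_z : ∀ {x w : ℂ}, w ≠ 0 → (∀ n : ℤ, x / w * q ^ n ≠ 1) → ∀ n : ℕ, x * q ^ (n + 1) ≠ w :=
    fun {x w} hw h n e => nat h (n + 1) (by rw [div_mul_eq_mul_div, e, div_self hw])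
  have hr : ‖q * a / z‖ < 1 := by
    rw [norm_div, div_lt_one (norm_pos_iff.2 hz0)]; exact hz₁
  -- Inversion turns the ratio `qa/z` into `qz/a`, so the upper bound on `|z|` governs the second
  -- series.
  have hr' : ‖q * (1 / a) / (1 / z)‖ < 1 := by
    rw [show q * (1 / a) / (1 / z) = z / (a / q) by field_simp, norm_div,
      div_lt_one (norm_pos_iff.2 (div_ne_zero ha0 hq0))]
    exact hz₂
  have hzk' : ∀ n : ℤ, 1 / k / (1 / z) * q ^ n ≠ 1 := by
    rwa [show 1 / k / (1 / z) = z / k by field_simp]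
  have hz0' : 1 / z ≠ 0 := one_div_ne_zero hz0
  have ha0' : 1 / a ≠ 0 := one_div_ne_zero ha0
  have f1 := fTerm_eq_vwpTerm (a := a) (z := z) (nat hk)
  have f2 := fTerm_eq_vwpTerm (a := 1 / a) (z := 1 / z) (nat hk')
  refine ⟨?_, ?_, ?_⟩
  · simpa [f1] using summable_vwpTerm_shift hz0 hq0 hq1 (ne_z hz0 hkz) (fun n => nat ha (n + 1)) hr 0
  · simp only [f2]
    simpa only [pow_zero, mul_one] using summable_vwpTerm_shift hz0' hq0 hq1 (ne_z hz0' hzk')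
      (fun n => nat ha' (n + 1)) hr' 0
  simp only [fSeries, f1, f2]
  rw [tsum_vwpTerm ha0 hz0 hq0 hq1 (fun n => nat hk (n + 1)) (ne_z hz0 hkz)
      (fun n => nat ha (n + 1)) hr,
    tsum_vwpTerm ha0' hz0' hq0 hq1 (fun n => nat hk' (n + 1)) (ne_z hz0' hzk')
      (fun n => nat ha' (n + 1)) hr']
  have theta_ne : ∀ {x : ℂ}, x ≠ 0 → (∀ n : ℤ, x * q ^ n ≠ 1) → qTheta q x ≠ 0 := fun {x} hx h =>
    mul_ne_zero (qPochInf_ne_zero hq1 (nat h)) (qPochInf_ne_zero hq1 fun n e =>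
      nat (inv_mul_zpow_ne_one h) (n + 1) (by rw [← e]; ring))
  have hprod : z / k * (qPochsInf [z, q / z, k / a, q * a / k, a * k / z, q * z / (a * k), q, q] q /
      qPochsInf [z / k, q * k / z, z / a, q * a / z, a, q / a, k, q / k] q) =
      thetaLambert q k + thetaLambert q (a / z) - thetaLambert q (k / z) - thetaLambert q a := by
    have n1 := theta_ne (div_ne_zero hz0 hk0) hzk
    have n2 := theta_ne (div_ne_zero hz0 ha0) hza
    have n3 := theta_ne ha0 ha
    have n4 := theta_ne hk0 hk
    have e1 : qPochsInf [z, q / z, k / a, q * a / k, a * k / z, q * z / (a * k), q, q] q =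
        qTheta q z * qTheta q (k / a) * qTheta q (a * k / z) * (qPochInf q q * qPochInf q q) := by
      simp only [qPochsInf, qTheta, List.map_cons, List.map_nil, List.prod_cons, List.prod_nil,
        div_div_eq_mul_div]
      ring
    have e2 : qPochsInf [z / k, q * k / z, z / a, q * a / z, a, q / a, k, q / k] q =
        qTheta q (z / k) * qTheta q (z / a) * qTheta q a * qTheta q k := by
      simp only [qPochsInf, qTheta, List.map_cons, List.map_nil, List.prod_cons, List.prod_nil,
        div_div_eq_mul_div]
      ring
    rw [e1, e2, ← thetaLambert_mul_qTheta hq0 hq1 ha0 hk0 hz0 ha hk hkz haz,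
      mul_div_cancel_right₀ _ (mul_ne_zero (mul_ne_zero (mul_ne_zero n1 n2) n3) n4)]
    field_simp
  -- The terms `x/(1-x)` belong to `thetaLambert` but not to the Lambert series of `f`; their
  -- combination is the rational part.
  have hrat : (a - k) * (1 - 1 / z) * (1 - a * k / z) /
      ((1 - a) * (1 - k) * (1 - a / z) * (1 - k / z)) =
      -(k / (1 - k) + a / z / (1 - a / z) - k / z / (1 - k / z) - a / (1 - a)) := by
    have m1 : 1 - a ≠ 0 := sub_ne_zero.2 (by simpa using (ha 0).symm)
    have m2 : 1 - k ≠ 0 := sub_ne_zero.2 (by simpa using (hk 0).symm)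
    have m3 : z - a ≠ 0 := sub_ne_zero.2 fun h => haz 0 (by rw [← h]; simp [hz0])
    have m4 : z - k ≠ 0 := sub_ne_zero.2 fun h => hkz 0 (by rw [← h]; simp [hz0])
    rw [show 1 - a / z = (z - a) / z by field_simp, show 1 - k / z = (z - k) / z by field_simp]
    field_simp
    ring
  rw [hprod, hrat]
  simp only [thetaLambert, div_div_eq_mul_div, one_div_mul_eq_div, one_mul, div_one]
  ring
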